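/- Balls and distances in $\mathbb{R}^2$ are taken with respect to the supremum norm, $\lambda$ is Lebesgue measure and $I^2=[-1/2,1/2]^2$. Let $(l_n)$, $(m_n)$ be sequences of even positive integers with $m_n\mid l_n$, $l_n\mid l_{n+1}$ and $l_n,\,m_n,\,l_n/m_n\to\infty$. Let $(S_n)$ be pairwise disjoint closed axis-parallel squares of side length $l_n$ whose vertices have even integer coordinates, let $(T_{n,i})_{1\le i\le m_n^2}$ be the subdivision of $S_n$ into closed squares of side length $l_n/m_n$, and let $\phi_n$ be the homothety of positive ratio $1/l_n$ mapping $S_n$ onto $I^2$. Let $\rho:I^2\to\mathbb{R}$ be continuous with $8/9\le\rho\le 1$, and let $\mathcal{D}_\rho\subset\mathbb{Z}^2$ be a set such that, for all $n,i$: $\mathcal{D}_\rho\cap T_{n,i}$ has exactly $\left\lfloor\int_{T_{n,i}}\rho\circ\phi_n\,d\lambda\right\rfloor$ points, $T_{n,i}\cap(2\mathbb{Z}\times\mathbb{Z})$, $T_{n,i}\cap(\mathbb{Z}\times2\mathbb{Z})$ and $\partial T_{n,i}\cap\mathbb{Z}^2$ are contained in $\mathcal{D}_\rho$; and such that $\mathbb{Z}^2\setminus\bigcup_n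 S_n\subset\mathcal{D}_\rho$. Let $f:\mathcal{D}_\rho\to\mathbb{Z}^2$ be an $L$-Lipschitz bijection which is $\omega$-co-uniformly continuous, i.e. $f^{-1}(B(f(x),r))\subset B(x,\omega(r))$ for all $x\in\mathcal{D}_\rho$ and $r>0$, where $\omega:(0,\infty)\to(0,\infty)$ is increasing and continuous and $\omega(r)=o(r^2)$ as $r\to\infty$. Put $\mathcal{R}_n=\phi_n(\mathcal{D}_\rho\cap S_n)$, choose $\tilde x_n\in\mathcal{R}_n$, and let $f_n:\mathcal{R}_n\to\frac1{l_n}\mathbb{Z}^2$, $$f_n(x)=\tfrac{1}{l_n}\bigl(f(\phi_n^{-1}(x))-f(\phi_n^{-1}(\tilde x_n))\bigr).$$ Let $\widehat f_n:I^2\to\mathbb{R}^2$ be $L$-Lipschitz extensions of the $f_n$, and let $F:I^2\to\mathbb{R}^2$ be the uniform limit of some subsequence of $(\widehat f_n)$. Let $W\subset F(I^2)$ be an open set for which there are finitely many pairwise disjoint open sets $V_1,\dots,V_N\subset I^2$ with $F^{-1}(W)=\bigcup_{i=1}^N V_i$ such that each $F|_{V_i}:V_i\to W$ is a bi-Lipschitz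 bijection. Let $\mathcal{Q}\subset W$ be a closed ball of positive radius centred at a point of $\frac{1}{l_m}\mathbb{Z}^2$ for some index $m$. Then $$F_{\#}(\rho\lambda)|_{\mathcal{Q}}=\lambda|_{\mathcal{Q}},$$ where $\rho\lambda(A)=\int_A\rho\,d\lambda$ for measurable $A\subset I^2$ and $F_\#(\rho\lambda)(B)=\rho\lambda(F^{-1}(B))$. -/

import Mathlib

open Set Filter Topology MeasureTheory
open scoped NNReal

noncomputable section

namespace DeloneRenorm

/-- The plane. Its norm is the supremum norm, so `Metric.ball` and `Metric.closedBall` are squares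
with sides parallel to the axes, and `volume` is Lebesgue measure. -/
abbrev Plane : Type := Fin 2 → ℝ

/-- The unit square `I² = [-1/2, 1/2]²`. -/
def unitSquare : Set Plane := Icc (fun _ => -(1 / 2 : ℝ)) (fun _ => (1 / 2 : ℝ))

/-- The standard lattice `ℤ²` inside the plane. -/
def lattice : Set Plane := {x | ∀ c, ∃ k : ℤ, x c = k}

/-- The scaled lattice `(1/l)ℤ²`. -/
def scaledLattice (l : ℕ) : Set Plane := (fun x : Plane => (1 / (l : ℝ)) • x) '' lattice

/-- The set `2ℤ × ℤ`. -/
def evenFirst : Set Plane := {x | x ∈ lattice ∧ ∃ k : ℤ, x 0 = 2 * k}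

/-- The set `ℤ × 2ℤ`. -/
def evenSecond : Set Plane := {x | x ∈ lattice ∧ ∃ k : ℤ, x 1 = 2 * k}

/-- The closed axis-parallel square with lower left vertex `s` and side length `l`. -/
def bigSquare (s : Fin 2 → ℤ) (l : ℕ) : Set Plane :=
  Icc (fun c => (s c : ℝ)) (fun c => (s c : ℝ) + l)

/-- The `i`-th closed square of the subdivision of `bigSquare s l` into `m²` squares of side
length `l / m`. -/
def smallSquare (s : Fin 2 → ℤ) (l m : ℕ) (i : Fin 2 → Fin m) : Set Plane :=
  Icc (fun c => (s c : ℝ) + ((i c : ℕ) : ℝ) * ((l : ℝ) / m))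
    (fun c => (s c : ℝ) + (((i c : ℕ) : ℝ) + 1) * ((l : ℝ) / m))

/-- The homothety `φ` that sends `bigSquare s l` onto the unit square. -/
def chart (s : Fin 2 → ℤ) (l : ℕ) (x : Plane) : Plane :=
  fun c => (x c - (s c : ℝ)) / l - 1 / 2

/-- The inverse homothety `φ⁻¹`. -/
def chartInv (s : Fin 2 → ℤ) (l : ℕ) (x : Plane) : Plane :=
  fun c => (s c : ℝ) + l * (x c + 1 / 2)

theorem chartInv_chart (s : Fin 2 → ℤ) {l : ℕ} (hl : 0 < l) (x : Plane) :
    chartInv s l (chart s l x) = x := by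
  have h : (l : ℝ) ≠ 0 := by exact_mod_cast hl.ne'
  funext c
  simp only [chartInv, chart]
  field_simp
  ring

theorem chart_chartInv (s : Fin 2 → ℤ) {l : ℕ} (hl : 0 < l) (x : Plane) :
    chart s l (chartInv s l x) = x := by
  have h : (l : ℝ) ≠ 0 := by exact_mod_cast hl.ne'
  funext c
  simp only [chartInv, chart]
  field_simp
  ring

/-- The sequences `l n`, `m n` and the squares `S n = bigSquare (s n) (l n)` used in the
construction of the Delone set. -/
structure IsSquareSystem (l m : ℕ → ℕ) (s : ℕ → Fin 2 → ℤ) : Prop where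
  l_pos : ∀ n, 0 < l n
  m_pos : ∀ n, 0 < m n
  l_even : ∀ n, Even (l n)
  m_even : ∀ n, Even (m n)
  m_dvd_l : ∀ n, m n ∣ l n
  l_tendsto : Tendsto l atTop atTop
  m_tendsto : Tendsto m atTop atTop
  ratio_tendsto : Tendsto (fun n => (l n : ℝ) / m n) atTop atTop
  l_dvd_succ : ∀ n, l n ∣ l (n + 1)
  vertex_even : ∀ n c, Even (s n c)
  disjoint : Pairwise fun n n' => Disjoint (bigSquare (s n) (l n)) (bigSquare (s n') (l n'))

/-- `D` is a Delone set `D_ρ` built from the density `ρ` on the unit square: each small square `T`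
carries `⌊∫_T ρ ∘ φ⌋` points of `D`, satisfies the `2ℤ²`-property and has all the integer points of
its boundary in `D`; outside the big squares every integer point belongs to `D`. -/
structure IsDensitySet (l m : ℕ → ℕ) (s : ℕ → Fin 2 → ℤ) (ρ : Plane → ℝ) (D : Set Plane) :
    Prop where
  subset_lattice : D ⊆ lattice
  card_eq : ∀ n (i : Fin 2 → Fin (m n)),
    (D ∩ smallSquare (s n) (l n) (m n) i).ncard =
      ⌊∫ x in smallSquare (s n) (l n) (m n) i, ρ (chart (s n) (l n) x)⌋₊
  evenFirst_subset : ∀ n (i : Fin 2 → Fin (m n)),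
    smallSquare (s n) (l n) (m n) i ∩ evenFirst ⊆ D
  evenSecond_subset : ∀ n (i : Fin 2 → Fin (m n)),
    smallSquare (s n) (l n) (m n) i ∩ evenSecond ⊆ D
  boundary_subset : ∀ n (i : Fin 2 → Fin (m n)),
    frontier (smallSquare (s n) (l n) (m n) i) ∩ lattice ⊆ D
  outside_subset : lattice \ ⋃ n, bigSquare (s n) (l n) ⊆ D

/-- `ω : (0,∞) → (0,∞)` is increasing and continuous. -/
structure IsModulus (ω : ℝ → ℝ) : Prop where
  pos : ∀ r, 0 < r → 0 < ω r
  mono : MonotoneOn ω (Ioi 0)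
  cont : ContinuousOn ω (Ioi 0)

/-- The map `f`, considered on `D`, is `ω`-co-uniformly continuous:
`f⁻¹(B(f x, r)) ⊆ B(x, ω r)` for all `x ∈ D` and `r > 0`. -/
def IsCoUniform (ω : ℝ → ℝ) (D : Set Plane) (f : Plane → Plane) : Prop :=
  ∀ x ∈ D, ∀ r, 0 < r → D ∩ f ⁻¹' Metric.ball (f x) r ⊆ Metric.ball x (ω r)

/-- The rescaled set `R = φ(D ∩ S)`, where `S = bigSquare s l`. -/
def rescaledSet (s : Fin 2 → ℤ) (l : ℕ) (D : Set Plane) : Set Plane :=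
  chart s l '' (D ∩ bigSquare s l)

/-- The normalization `x ↦ (f (φ⁻¹ x) - f (φ⁻¹ x₀)) / l` of `f` with base point `x₀`. -/
def normalizedMap (s : Fin 2 → ℤ) (l : ℕ) (f : Plane → Plane) (x₀ x : Plane) : Plane :=
  (1 / (l : ℝ)) • (f (chartInv s l x) - f (chartInv s l x₀))

/-- `F` is a renormalized limit of the `L`-Lipschitz map `f` on `D`: for some base points
`x₀ n ∈ R n` and some `L`-Lipschitz extensions `fhat n : I² → ℝ²` of the normalizations
`f n : R n → (1 / l n)ℤ²`, a subsequence of `fhat` converges to `F` uniformly on `I²`. -/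
def IsRenormalizedLimit (l : ℕ → ℕ) (s : ℕ → Fin 2 → ℤ) (D : Set Plane) (f : Plane → Plane)
    (L : ℝ≥0) (F : Plane → Plane) : Prop :=
  ∃ (x₀ : ℕ → Plane) (fhat : ℕ → Plane → Plane) (σ : ℕ → ℕ),
    (∀ n, x₀ n ∈ rescaledSet (s n) (l n) D) ∧
    (∀ n, LipschitzOnWith L (fhat n) unitSquare) ∧
    (∀ n, EqOn (fhat n) (normalizedMap (s n) (l n) f (x₀ n)) (rescaledSet (s n) (l n) D)) ∧
    StrictMono σ ∧
    TendstoUniformlyOn (fun k => fhat (σ k)) F atTop unitSquare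

/-- On the set `V`, the map `F` is `(b, C)`-bi-Lipschitz. -/
def IsBiLipschitzOn (b C : ℝ) (F : Plane → Plane) (V : Set Plane) : Prop :=
  ∀ x ∈ V, ∀ y ∈ V, b * dist x y ≤ dist (F x) (F y) ∧ dist (F x) (F y) ≤ C * dist x y

/-- Over the open set `W ⊆ F(I²)`, the map `F : I² → ℝ²` decomposes into finitely many bi-Lipschitz
pieces: `F⁻¹(W)` is the disjoint union of open sets `V 0, …, V (N - 1)` contained in `I²`, each of
which `F` maps bi-Lipschitzly onto `W`. -/
def DecomposesOver (F : Plane → Plane) (W : Set Plane) : Prop :=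
  IsOpen W ∧ W ⊆ F '' unitSquare ∧
    ∃ (N : ℕ) (V : Fin N → Set Plane),
      (∀ i, IsOpen (V i)) ∧ (∀ i, V i ⊆ unitSquare) ∧
      (Pairwise fun i j => Disjoint (V i) (V j)) ∧
      (⋃ i, V i) = unitSquare ∩ F ⁻¹' W ∧
      (∀ i, BijOn F (V i) W) ∧
      ∀ i, ∃ b C : ℝ, 0 < b ∧ 0 < C ∧ IsBiLipschitzOn b C F (V i)

/-- The measure `ρλ` on the unit square. -/
def densityMeasure (ρ : Plane → ℝ) : Measure Plane :=
  (volume.restrict unitSquare).withDensity fun x => ENNReal.ofReal (ρ x)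

end DeloneRenorm

end

/-! Let `μ_n = l_n⁻² ∑_{x ∈ R_n} δ_x`. Each tile of side length `a = l_n / m_n` carries its
prescribed number of points up to an error `O(a)` coming from the boundary, so summing over the
`m_n²` tiles gives a total error `O(m_n / l_n)`; the tiles shrink after rescaling, hence
`μ_n → ρλ` weakly.

Co-uniformity at the single scale `2` makes `f⁻¹ : ℤ² → D` Lipschitz, because lattice points are
joined by chains of unit steps, and this survives rescaling: the normalizations of `f` contract
distances at most by a fixed factor. Thus every point of `l_n⁻¹ ℤ²` in a compact set `E ⊆ W` is
the image, under the normalization of `f` on all of `D`, of a point close to `I² ∩ F⁻¹(E)`; as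
`I² ∩ F⁻¹(W)` is open, that point lies in `I²`, and no lattice point of `E` is missed by `f_n`.
For `ψ` continuous with compact support in `W` this gives, for `n` large,

  `∫ ψ ∘ f_n dμ_n = l_n⁻² ∑_{p ∈ l_n⁻¹ ℤ²} ψ p`.

Along the subsequence the left side tends to `∫ ψ ∘ F d(ρλ)`, and the right side is a Riemann sum
for `∫ ψ dλ`.
-/

namespace DeloneRenorm

section General

variable {X Y : Type*}

-- Two points of `ℤ^ι` at distance `n` are joined by a chain of `n` steps of length at most one.
lemma lipschitzWith_of_dist_le_one {ι : Type*} [Fintype ι] [PseudoMetricSpace X]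
    {g : (ι → ℤ) → X} {C : ℝ≥0} (h : ∀ z w, dist z w ≤ 1 → dist (g z) (g w) ≤ C) :
    LipschitzWith C g := by
  have chain (n : ℕ) (z w : ι → ℤ) (hzw : dist z w ≤ n) : dist (g z) (g w) ≤ C * n := by
    induction n generalizing z with
    | zero =>
      obtain rfl : z = w := dist_le_zero.1 (by simpa using hzw)
      simp
    | succ n ih =>
      let u : ι → ℤ := fun c => z c + (w c - z c).sign
      have hcoord (c : ι) : |z c - u c| ≤ 1 ∧ |u c - w c| ≤ n := by
        have hc : |z c - w c| ≤ n + 1 := by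
          exact_mod_cast (Int.dist_eq (z c) (w c)).ge.trans ((dist_le_pi_dist z w c).trans hzw)
        rcases lt_trichotomy (w c - z c) 0 with hlt | heq | hgt
        · grind [Int.sign_eq_neg_one_of_neg hlt]
        · grind [Int.sign_zero]
        · grind [Int.sign_eq_one_of_pos hgt]
      have hzu : dist z u ≤ 1 := (dist_pi_le_iff zero_le_one).2 fun c => by
        rw [Int.dist_eq]
        exact_mod_cast (hcoord c).1
      have huw : dist u w ≤ n := (dist_pi_le_iff n.cast_nonneg).2 fun c => by
        rw [Int.dist_eq]
        exact_mod_cast (hcoord c).2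
      calc dist (g z) (g w) ≤ dist (g z) (g u) + dist (g u) (g w) := dist_triangle _ _ _
        _ ≤ C + C * n := add_le_add (h z u hzu) (ih u huw)
        _ = C * (n + 1 : ℕ) := by push_cast; ring
  refine LipschitzWith.of_dist_le_mul fun z w => (chain ⌊dist z w⌋₊ z w ?_).trans ?_
  · refine (dist_pi_le_iff (Nat.cast_nonneg _)).2 fun c => ?_
    have hc : ((z c - w c).natAbs : ℝ) = dist (z c) (w c) := by
      rw [Int.dist_eq, Nat.cast_natAbs]; push_cast; rfl
    rw [← hc]
    exact_mod_cast Nat.le_floor (hc.trans_le (dist_le_pi_dist z w c))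
  · gcongr
    exact Nat.floor_le dist_nonneg

lemma abs_setIntegral_sub_setIntegral_le [MeasurableSpace X] {μ ν : Measure X} {T : Set X}
    (hT : MeasurableSet T) (hμT : μ T ≠ ⊤) (hνT : ν T ≠ ⊤) {h : X → ℝ} {M e : ℝ}
    (hμ : IntegrableOn h T μ) (hν : IntegrableOn h T ν) (hM : ∀ x ∈ T, |h x| ≤ M)
    (he : ∀ x ∈ T, ∀ y ∈ T, |h x - h y| ≤ e) :
    |∫ x in T, h x ∂μ - ∫ x in T, h x ∂ν| ≤
      e * (μ.real T + ν.real T) + M * |μ.real T - ν.real T| := by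
  rcases T.eq_empty_or_nonempty with rfl | ⟨y, hy⟩
  · simp
  have hdev {κ : Measure X} (hκT : κ T ≠ ⊤) (hκ : IntegrableOn h T κ) :
      |∫ x in T, h x ∂κ - κ.real T * h y| ≤ e * κ.real T := by
    rw [← smul_eq_mul, ← setIntegral_const, ← integral_sub hκ (integrableOn_const hκT),
      ← Real.norm_eq_abs]
    exact norm_setIntegral_le_of_norm_le_const hκT.lt_top fun x hx => he x hx y hy
  calc |∫ x in T, h x ∂μ - ∫ x in T, h x ∂ν|
      = |(∫ x in T, h x ∂μ - μ.real T * h y) - (∫ x in T, h x ∂ν - ν.real T * h y) +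
          h y * (μ.real T - ν.real T)| := by ring_nf
    _ ≤ e * μ.real T + e * ν.real T + M * |μ.real T - ν.real T| := by
      grw [abs_add_le, abs_sub, hdev hμT hμ, hdev hνT hν, abs_mul, hM y hy]
    _ = e * (μ.real T + ν.real T) + M * |μ.real T - ν.real T| := by ring

lemma abs_setIntegral_iUnion_sub_le [MeasurableSpace X] {ι : Type*} [Fintype ι]
    {μ ν : Measure X} {T : ι → Set X} (hT : ∀ i, MeasurableSet (T i))
    (hdisj : Pairwise fun i j => Disjoint (T i) (T j)) (hμT : μ (⋃ i, T i) ≠ ⊤)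
    (hνT : ν (⋃ i, T i) ≠ ⊤) {h : X → ℝ} {M e : ℝ} (hμ : IntegrableOn h (⋃ i, T i) μ)
    (hν : IntegrableOn h (⋃ i, T i) ν) (hM : ∀ x ∈ ⋃ i, T i, |h x| ≤ M)
    (he : ∀ i, ∀ x ∈ T i, ∀ y ∈ T i, |h x - h y| ≤ e) :
    |∫ x in ⋃ i, T i, h x ∂μ - ∫ x in ⋃ i, T i, h x ∂ν| ≤
      e * (μ.real (⋃ i, T i) + ν.real (⋃ i, T i)) + M * ∑ i, |μ.real (T i) - ν.real (T i)| := by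
  have hsub (i : ι) : T i ⊆ ⋃ j, T j := subset_iUnion T i
  have hreal {κ : Measure X} (hκ : κ (⋃ i, T i) ≠ ⊤) :
      κ.real (⋃ i, T i) = ∑ i, κ.real (T i) :=
    measureReal_iUnion_fintype hdisj hT fun i => measure_ne_top_of_subset (hsub i) hκ
  rw [integral_iUnion_fintype hT hdisj fun i => hμ.mono_set (hsub i),
    integral_iUnion_fintype hT hdisj fun i => hν.mono_set (hsub i), ← Finset.sum_sub_distrib,
    hreal hμT, hreal hνT, ← Finset.sum_add_distrib, Finset.mul_sum, Finset.mul_sum,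
    ← Finset.sum_add_distrib]
  exact (Finset.abs_sum_le_sum_abs _ _).trans <| Finset.sum_le_sum fun i _ =>
    abs_setIntegral_sub_setIntegral_le (hT i) (measure_ne_top_of_subset (hsub i) hμT)
      (measure_ne_top_of_subset (hsub i) hνT) (hμ.mono_set (hsub i)) (hν.mono_set (hsub i))
      (fun x hx => hM x (hsub i hx)) (he i)

lemma tendsto_setIntegral_sub_of_tendstoUniformlyOn [MeasurableSpace X] {μ : ℕ → Measure X}
    {S : Set X} {C : ℝ} (hμS : ∀ k, μ k S ≠ ⊤) (hC : ∀ k, (μ k).real S ≤ C) {g : ℕ → X → ℝ}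
    {h : X → ℝ} (hg : ∀ k, IntegrableOn (g k) S (μ k)) (hh : ∀ k, IntegrableOn h S (μ k))
    (hgh : TendstoUniformlyOn g h atTop S) :
    Tendsto (fun k => ∫ x in S, g k x ∂μ k - ∫ x in S, h x ∂μ k) atTop (𝓝 0) := by
  refine Metric.tendsto_atTop.2 fun ε hε => ?_
  have hC0 : 0 ≤ C := measureReal_nonneg.trans (hC 0)
  obtain ⟨N, hN⟩ := eventually_atTop.1
    (Metric.tendstoUniformlyOn_iff.1 hgh (ε / (C + 1)) (by positivity))
  refine ⟨N, fun k hk => ?_⟩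
  rw [dist_zero_right, ← integral_sub (hg k) (hh k)]
  calc ‖∫ x in S, (g k x - h x) ∂μ k‖ ≤ ε / (C + 1) * (μ k).real S :=
        norm_setIntegral_le_of_norm_le_const (hμS k).lt_top fun x hx => by
          rw [← dist_eq_norm, dist_comm]
          exact (hN k hk x hx).le
    _ ≤ ε / (C + 1) * C := by gcongr; exact hC k
    _ < ε := by
      rw [div_mul_eq_mul_div, div_lt_iff₀ (by positivity)]
      nlinarith

lemma measure_le_of_integral_eq [TopologicalSpace X] [T2Space X] [LocallyCompactSpace X]
    [MeasurableSpace X] [OpensMeasurableSpace X] {μ ν : Measure X} [μ.Regular]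
    [IsFiniteMeasureOnCompacts ν] {U : Set X} (hU : IsOpen U)
    (h : ∀ ψ : X → ℝ, Continuous ψ → HasCompactSupport ψ → tsupport ψ ⊆ U →
      ∫ x, ψ x ∂μ = ∫ x, ψ x ∂ν) :
    μ U ≤ ν U := by
  rw [hU.measure_eq_iSup_isCompact]
  refine iSup₂_le fun K hKU => iSup_le fun hK => ?_
  obtain ⟨ψ, hψK, hψc, hψU, hψ⟩ := exists_continuousMap_one_of_isCompact_subset_isOpen hK hU hKU
  have hint (κ : Measure X) [IsFiniteMeasureOnCompacts κ] : Integrable ψ κ :=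
    ψ.continuous.integrable_of_hasCompactSupport hψc
  have hψ0 : 0 ≤ ψ := fun x => (hψ x).1
  calc μ K = ENNReal.ofReal (∫ x, K.indicator 1 x ∂μ) := by
        rw [integral_indicator_one hK.measurableSet, ofReal_measureReal hK.measure_lt_top.ne]
    _ ≤ ENNReal.ofReal (∫ x, ψ x ∂μ) := by
      refine ENNReal.ofReal_le_ofReal (integral_mono_of_nonneg ?_ (hint μ) ?_)
      · exact ae_of_all _ (indicator_nonneg fun _ _ => zero_le_one)
      · exact ae_of_all _ (indicator_le' (fun x hx => (hψK hx).ge) fun x _ => hψ0 x)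
    _ = ∫⁻ x, ENNReal.ofReal (ψ x) ∂ν := by
      rw [h ψ ψ.continuous hψc hψU,
        ofReal_integral_eq_lintegral_ofReal (hint ν) (ae_of_all _ hψ0)]
    _ ≤ ∫⁻ x, U.indicator 1 x ∂ν := by
      refine lintegral_mono fun x => ?_
      by_cases hx : x ∈ U
      · simpa [hx] using (hψ x).2
      · simp [hx, image_eq_zero_of_notMem_tsupport fun hx' => hx (hψU hx')]
    _ = ν U := lintegral_indicator_one hU.measurableSet

lemma restrict_eq_restrict_of_integral_eq [MetricSpace X] [ProperSpace X]
    [MeasurableSpace X] [BorelSpace X] {μ ν : Measure X} [IsFiniteMeasureOnCompacts μ]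
    [IsFiniteMeasureOnCompacts ν] {W : Set X} (hW : IsOpen W)
    (h : ∀ ψ : X → ℝ, Continuous ψ → HasCompactSupport ψ → tsupport ψ ⊆ W →
      ∫ x, ψ x ∂μ = ∫ x, ψ x ∂ν) :
    μ.restrict W = ν.restrict W := by
  refine Measure.OuterRegular.ext_isOpen fun U hU => ?_
  rw [Measure.restrict_apply hU.measurableSet, Measure.restrict_apply hU.measurableSet]
  have hUW : IsOpen (U ∩ W) := hU.inter hW
  have hsub {ψ : X → ℝ} (hψ : tsupport ψ ⊆ U ∩ W) : tsupport ψ ⊆ W := hψ.trans inter_subset_right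
  exact le_antisymm
    (measure_le_of_integral_eq hUW fun ψ hψ hc hs => h ψ hψ hc (hsub hs))
    (measure_le_of_integral_eq hUW fun ψ hψ hc hs => (h ψ hψ hc (hsub hs)).symm)

lemma tendsto_setIntegral_of_tendsto_sum_abs_sub [PseudoMetricSpace X] [MeasurableSpace X]
    {ι : ℕ → Type*} [∀ n, Fintype (ι n)] {U : Set X} {T : ∀ n, ι n → Set X}
    (hT : ∀ n i, MeasurableSet (T n i))
    (hdisj : ∀ n, Pairwise fun i j => Disjoint (T n i) (T n j)) (hTU : ∀ n, ⋃ i, T n i = U)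
    {d : ℕ → ℝ} (hd : Tendsto d atTop (𝓝 0))
    (hTd : ∀ n i, ∀ x ∈ T n i, ∀ y ∈ T n i, dist x y ≤ d n) {μ : ℕ → Measure X} {ν : Measure X}
    {C : ℝ} (hμU : ∀ n, μ n U ≠ ⊤) (hC : ∀ n, (μ n).real U ≤ C) (hνU : ν U ≠ ⊤)
    (hμν : Tendsto (fun n => ∑ i, |(μ n).real (T n i) - ν.real (T n i)|) atTop (𝓝 0))
    {h : X → ℝ} {M : ℝ} (hM : ∀ x ∈ U, |h x| ≤ M) (hh : UniformContinuousOn h U)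
    (hμ : ∀ n, IntegrableOn h U (μ n)) (hν : IntegrableOn h U ν) :
    Tendsto (fun n => ∫ x in U, h x ∂μ n) atTop (𝓝 (∫ x in U, h x ∂ν)) := by
  refine Metric.tendsto_nhds.2 fun ε hε => ?_
  set B : ℝ := C + ν.real U
  have hB : 0 ≤ B := add_nonneg (measureReal_nonneg.trans (hC 0)) measureReal_nonneg
  obtain ⟨δ, hδ, hhδ⟩ := Metric.uniformContinuousOn_iff.1 hh (ε / (2 * (B + 1))) (by positivity)
  have hMμν := hμν.const_mul M
  rw [mul_zero] at hMμν
  filter_upwards [hd.eventually_lt_const hδ, hMμν.eventually_lt_const (half_pos hε)] with n hdn hn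
  have hsub (i : ι n) : T n i ⊆ U := hTU n ▸ subset_iUnion (T n) i
  have hosc (i : ι n) (x) (hx : x ∈ T n i) (y) (hy : y ∈ T n i) :
      |h x - h y| ≤ ε / (2 * (B + 1)) :=
    (hhδ x (hsub i hx) y (hsub i hy) ((hTd n i x hx y hy).trans_lt hdn)).le
  have hbound := abs_setIntegral_iUnion_sub_le (hT n) (hdisj n) ((hTU n).symm ▸ hμU n)
    ((hTU n).symm ▸ hνU) ((hTU n).symm ▸ hμ n) ((hTU n).symm ▸ hν) ((hTU n).symm ▸ hM) hosc
  rw [hTU n] at hbound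
  calc dist (∫ x in U, h x ∂μ n) (∫ x in U, h x ∂ν)
      ≤ ε / (2 * (B + 1)) * ((μ n).real U + ν.real U) +
          M * ∑ i, |(μ n).real (T n i) - ν.real (T n i)| := hbound
    _ ≤ ε / (2 * (B + 1)) * (B + 1) + M * ∑ i, |(μ n).real (T n i) - ν.real (T n i)| := by
      gcongr ε / (2 * (B + 1)) * ?_ + _
      exact (add_le_add_left (hC n) _).trans (lt_add_one B).le
    _ < ε / 2 + ε / 2 := by
      refine add_lt_add_of_le_of_lt (le_of_eq ?_) hn
      field_simp
    _ = ε := add_halves ε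

lemma exists_eq_and_dist_le [PseudoMetricSpace X] [PseudoMetricSpace Y] {A S : Set X} {B : Set Y}
    {g G : X → Y} {K L : ℝ≥0} (hg : SurjOn g A B) (hgK : AntilipschitzWith K (A.domRestrict g))
    (hG : LipschitzOnWith L G S) (hGg : EqOn G g (A ∩ S)) {u q : X} {p : Y} {η ε : ℝ}
    (hu : u ∈ A ∩ S) (hq : q ∈ S) (huq : dist u q ≤ η) (hp : p ∈ B) (hpq : dist p (G q) ≤ ε) :
    ∃ x ∈ A, g x = p ∧ dist x q ≤ K * (ε + L * η) + η := by
  obtain ⟨x, hxA, rfl⟩ := hg hp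
  refine ⟨x, hxA, rfl, ?_⟩
  calc dist x q ≤ dist x u + dist u q := dist_triangle _ _ _
    _ ≤ K * dist (g x) (g u) + η := add_le_add (hgK.le_mul_dist ⟨x, hxA⟩ ⟨u, hu.1⟩) huq
    _ ≤ K * (dist (g x) (G q) + dist (G q) (G u)) + η := by
      rw [← hGg hu]
      gcongr
      exact dist_triangle _ _ _
    _ ≤ K * (ε + L * η) + η := by
      gcongr
      rw [dist_comm] at huq
      exact (hG.dist_le_mul q hq u hu.2).trans (by gcongr)

end General

/-- The inclusion of `ℤ²` into the plane, whose range is `lattice`. -/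
def toPlane (z : Fin 2 → ℤ) : Plane := fun c => (z c : ℝ)

lemma isometry_toPlane : Isometry toPlane :=
  Isometry.of_dist_eq fun z w => by
    simp only [dist_pi_def, toPlane]
    rfl

lemma range_toPlane : range toPlane = lattice := by
  ext x
  simp only [mem_range, lattice, mem_ofPred_eq, toPlane, funext_iff, eq_comm (b := x _),
    Classical.skolem]

lemma IsCoUniform.antilipschitzWith {ω : ℝ → ℝ} {D : Set Plane} {f : Plane → Plane}
    (hf : IsCoUniform ω D f) (hbij : BijOn f D lattice) :
    AntilipschitzWith (ω 2).toNNReal (D.domRestrict f) := by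
  let g (z : Fin 2 → ℤ) : Plane := Function.invFunOn f D (toPlane z)
  have hsurj (z : Fin 2 → ℤ) : toPlane z ∈ f '' D :=
    hbij.surjOn (range_toPlane ▸ mem_range_self z)
  have hgD (z : Fin 2 → ℤ) : g z ∈ D := Function.invFunOn_mem (hsurj z)
  have hfg (z : Fin 2 → ℤ) : f (g z) = toPlane z := Function.invFunOn_eq (hsurj z)
  have hg : LipschitzWith (ω 2).toNNReal g := lipschitzWith_of_dist_le_one fun z w hzw => by
    have hball : g w ∈ D ∩ f ⁻¹' Metric.ball (f (g z)) 2 := by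
      refine ⟨hgD w, ?_⟩
      rw [mem_preimage, Metric.mem_ball, hfg, hfg, isometry_toPlane.dist_eq, dist_comm]
      linarith
    rw [dist_comm]
    exact (Metric.mem_ball.1 (hf _ (hgD z) 2 two_pos hball)).le.trans (Real.le_coe_toNNReal _)
  refine AntilipschitzWith.of_le_mul_dist fun x y => ?_
  have hinv (x : D) : ∃ z, toPlane z = f x ∧ g z = x := by
    obtain ⟨z, hz⟩ : f x ∈ range toPlane := range_toPlane ▸ hbij.mapsTo x.2
    exact ⟨z, hz, hbij.injOn (hgD z) x.2 ((hfg z).trans hz)⟩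
  obtain ⟨z, hzf, hzx⟩ := hinv x
  obtain ⟨w, hwf, hwy⟩ := hinv y
  rw [Subtype.dist_eq, ← hzx, ← hwy, domRestrict_apply, domRestrict_apply, ← hzf, ← hwf,
    isometry_toPlane.dist_eq]
  exact hg.dist_le_mul z w

open scoped Pointwise in
lemma scaledLattice_eq_smul_span (l : ℕ) :
    scaledLattice l =
      (l : ℝ)⁻¹ • (Submodule.span ℤ (range (Pi.basisFun ℝ (Fin 2))) : Set Plane) := by
  have hspan : (Submodule.span ℤ (range (Pi.basisFun ℝ (Fin 2))) : Set Plane) = lattice := by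
    ext v
    rw [SetLike.mem_coe, Module.Basis.mem_span_iff_repr_mem ℤ (Pi.basisFun ℝ (Fin 2)) v]
    simp only [Pi.basisFun_repr, mem_range, algebraMap_int_eq, eq_intCast, lattice, mem_ofPred_eq,
      eq_comm]
  rw [hspan, ← one_div]
  rfl

lemma tsum_subtype_eq_of_inter_support_eq {X : Type*} {ψ : X → ℝ} {A B : Set X}
    (h : A ∩ Function.support ψ = B ∩ Function.support ψ) :
    ∑' x : A, ψ x = ∑' x : B, ψ x := by
  rw [tsum_subtype, tsum_subtype, ← indicator_inter_support, h, indicator_inter_support]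

lemma tendsto_tsum_scaledLattice_div_sq {ψ : Plane → ℝ} (hψ : Continuous ψ)
    (hψc : HasCompactSupport ψ) :
    Tendsto (fun l : ℕ => (∑' p : scaledLattice l, ψ p) / (l : ℝ) ^ 2) atTop
      (𝓝 (∫ x, ψ x)) := by
  obtain ⟨r, hr⟩ := hψc.isBounded.subset_closedBall (0 : Plane)
  have hlim := tendsto_tsum_div_pow_atTop_integral (Metric.closedBall (0 : Plane) r) ψ hψ
    Metric.isBounded_closedBall measurableSet_closedBall
    ((convex_closedBall (0 : Plane) r).addHaar_frontier volume)
  rw [setIntegral_eq_integral_of_forall_compl_eq_zero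
    fun x hx => image_eq_zero_of_notMem_tsupport fun h => hx (hr h), Fintype.card_fin] at hlim
  refine hlim.congr fun l => ?_
  rw [← scaledLattice_eq_smul_span, tsum_subtype_eq_of_inter_support_eq (B := scaledLattice l)]
  have hsupp : Function.support ψ ⊆ Metric.closedBall 0 r := (subset_tsupport ψ).trans hr
  rw [inter_right_comm, inter_eq_right.2 hsupp, inter_comm]

/-- The half-open square with lower left vertex `v` and side length `a`. Unlike closed squares,
half-open ones subdivide into pairwise disjoint pieces. -/
def halfOpenSquare (v : Plane) (a : ℝ) : Set Plane := univ.pi fun c => Ico (v c) (v c + a)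

/-- The half-open unit square `[-1/2, 1/2)²`. -/
def unitCell : Set Plane := halfOpenSquare (fun _ => -(1 / 2)) 1

lemma measurableSet_halfOpenSquare (v : Plane) (a : ℝ) : MeasurableSet (halfOpenSquare v a) :=
  MeasurableSet.univ_pi fun _ => measurableSet_Ico

lemma halfOpenSquare_ae_eq_Icc (v : Plane) (a : ℝ) :
    halfOpenSquare v a =ᵐ[volume] Icc v (fun c => v c + a) :=
  Measure.univ_pi_Ico_ae_eq_Icc

lemma halfOpenSquare_ae_eq_bigSquare (u : Fin 2 → ℤ) (a : ℕ) :
    halfOpenSquare (toPlane u) a =ᵐ[volume] bigSquare u a :=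
  halfOpenSquare_ae_eq_Icc _ _

lemma halfOpenSquare_subset_Icc (v : Plane) (a : ℝ) :
    halfOpenSquare v a ⊆ Icc v (fun c => v c + a) :=
  (pi_mono fun _ _ => Ico_subset_Icc_self).trans (pi_univ_Icc _ _).subset

lemma halfOpenSquare_subset_bigSquare (u : Fin 2 → ℤ) (a : ℕ) :
    halfOpenSquare (toPlane u) a ⊆ bigSquare u a :=
  halfOpenSquare_subset_Icc _ _

lemma unitSquare_eq_Icc : unitSquare = Icc (fun _ => -(1 / 2)) (fun _ => -(1 / 2) + 1) := by
  rw [unitSquare]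
  norm_num

lemma measurableSet_unitCell : MeasurableSet unitCell :=
  measurableSet_halfOpenSquare _ _

lemma unitCell_ae_eq_unitSquare : unitCell =ᵐ[volume] unitSquare := by
  rw [unitSquare_eq_Icc]
  exact halfOpenSquare_ae_eq_Icc _ _

lemma unitCell_subset_unitSquare : unitCell ⊆ unitSquare := by
  rw [unitSquare_eq_Icc]
  exact halfOpenSquare_subset_Icc _ _

lemma interior_unitSquare_subset_unitCell : interior unitSquare ⊆ unitCell := by
  rw [unitSquare_eq_Icc, ← pi_univ_Icc, interior_pi_set finite_univ]
  exact pi_mono fun c _ => by rw [interior_Icc]; exact Ioo_subset_Ico_self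

lemma isCompact_unitSquare : IsCompact unitSquare := isCompact_Icc

lemma ncard_lattice_inter_pi (A : Fin 2 → Set ℝ) :
    (lattice ∩ univ.pi A).ncard = ∏ c, ((↑) ⁻¹' A c : Set ℤ).ncard := by
  have himage : lattice ∩ univ.pi A = toPlane '' univ.pi fun c => ((↑) ⁻¹' A c : Set ℤ) := by
    rw [← range_toPlane, inter_comm, ← image_preimage_eq_inter_range]
    rfl
  simp only [himage, ncard_image_of_injective _ isometry_toPlane.injective, ncard_def,
    encard_pi_eq_prod_encard]
  exact map_prod ENat.toNatHom _ _

lemma ncard_lattice_inter_bigSquare (u : Fin 2 → ℤ) (a : ℕ) :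
    (lattice ∩ bigSquare u a).ncard = (a + 1) ^ 2 := by
  have hcount (c : Fin 2) : ((↑) ⁻¹' Icc (u c : ℝ) (u c + a) : Set ℤ).ncard = a + 1 := by
    rw [Int.preimage_Icc, Int.ceil_intCast, ← Int.cast_natCast a, ← Int.cast_add,
      Int.floor_intCast, ← Finset.coe_Icc, ncard_coe_finset, Int.card_Icc]
    lia
  rw [bigSquare, ← pi_univ_Icc, ncard_lattice_inter_pi]
  simp only [hcount, Finset.prod_const, Finset.card_univ, Fintype.card_fin]

lemma ncard_lattice_inter_halfOpenSquare (u : Fin 2 → ℤ) (a : ℕ) :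
    (lattice ∩ halfOpenSquare (toPlane u) a).ncard = a ^ 2 := by
  have hcount (c : Fin 2) : ((↑) ⁻¹' Ico (toPlane u c) (toPlane u c + a) : Set ℤ).ncard = a := by
    rw [toPlane, Int.preimage_Ico, Int.ceil_intCast, ← Int.cast_natCast a, ← Int.cast_add,
      Int.ceil_intCast, ← Finset.coe_Ico, ncard_coe_finset, Int.card_Ico]
    lia
  rw [halfOpenSquare, ncard_lattice_inter_pi]
  simp only [hcount, Finset.prod_const, Finset.card_univ, Fintype.card_fin]

lemma finite_lattice_inter_bigSquare (u : Fin 2 → ℤ) (a : ℕ) :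
    (lattice ∩ bigSquare u a).Finite :=
  finite_of_ncard_ne_zero (by rw [ncard_lattice_inter_bigSquare]; positivity)

lemma ncard_inter_halfOpenSquare_le {D : Set Plane} (hD : D ⊆ lattice) (u : Fin 2 → ℤ) (a : ℕ) :
    (D ∩ halfOpenSquare (toPlane u) a).ncard ≤ a ^ 2 := by
  rw [← ncard_lattice_inter_halfOpenSquare u a]
  exact ncard_le_ncard (inter_subset_inter_left _ hD) <|
    (finite_lattice_inter_bigSquare u a).subset <|
      inter_subset_inter_right _ (halfOpenSquare_subset_bigSquare u a)

lemma ncard_inter_bigSquare_le {D : Set Plane} (hD : D ⊆ lattice) (u : Fin 2 → ℤ) (a : ℕ) :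
    (D ∩ bigSquare u a).ncard ≤ (D ∩ halfOpenSquare (toPlane u) a).ncard + (2 * a + 1) := by
  have hsub := halfOpenSquare_subset_bigSquare u a
  have hfin := finite_lattice_inter_bigSquare u a
  have hDfin : (D ∩ bigSquare u a).Finite := hfin.subset (inter_subset_inter_left _ hD)
  have hle : ((D ∩ bigSquare u a) \ (D ∩ halfOpenSquare (toPlane u) a)).ncard ≤
      ((lattice ∩ bigSquare u a) \ (lattice ∩ halfOpenSquare (toPlane u) a)).ncard :=
    ncard_le_ncard (fun x hx => ⟨⟨hD hx.1.1, hx.1.2⟩, fun h => hx.2 ⟨hx.1.1, h.2⟩⟩) hfin.sdiff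
  have hDadd := ncard_sdiff_add_ncard_of_subset (inter_subset_inter_right D hsub) hDfin
  have hadd := ncard_sdiff_add_ncard_of_subset (inter_subset_inter_right lattice hsub) hfin
  rw [ncard_lattice_inter_bigSquare, ncard_lattice_inter_halfOpenSquare] at hadd
  linarith

lemma abs_ncard_inter_halfOpenSquare_sub_le {D : Set Plane} (hD : D ⊆ lattice) {u : Fin 2 → ℤ}
    {a : ℕ} {J : ℝ} (hJ : 0 ≤ J) (hcard : (D ∩ bigSquare u a).ncard = ⌊J⌋₊) :
    |((D ∩ halfOpenSquare (toPlane u) a).ncard : ℝ) - J| ≤ 2 * a + 2 := by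
  have hupper : ((D ∩ halfOpenSquare (toPlane u) a).ncard : ℝ) ≤ ⌊J⌋₊ := by
    rw [← hcard]
    exact_mod_cast ncard_le_ncard (inter_subset_inter_right D (halfOpenSquare_subset_bigSquare u a))
      ((finite_lattice_inter_bigSquare u a).subset (inter_subset_inter_left _ hD))
  have hlower : (⌊J⌋₊ : ℝ) ≤ (D ∩ halfOpenSquare (toPlane u) a).ncard + (2 * a + 1) := by
    rw [← hcard]
    exact_mod_cast ncard_inter_bigSquare_le hD u a
  rw [abs_le]
  constructor <;> linarith [Nat.floor_le hJ, Nat.lt_floor_add_one J]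

/-- The tile with index `i` in the subdivision of `unitCell` into `m²` half-open squares. -/
def unitTile (m : ℕ) (i : Fin 2 → Fin m) : Set Plane :=
  halfOpenSquare (fun c => -(1 / 2) + (i c : ℕ) / m) (1 / m)

/-- The lower left vertex of the `i`-th tile of side length `a` of a big square with lower left
vertex `s`. -/
def tileVertex (s : Fin 2 → ℤ) (a : ℕ) {m : ℕ} (i : Fin 2 → Fin m) : Fin 2 → ℤ :=
  fun c => s c + (i c : ℕ) * a

lemma mem_unitTile {m : ℕ} (hm : 0 < m) {i : Fin 2 → Fin m} {x : Plane} :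
    x ∈ unitTile m i ↔ ∀ c, ⌊m * (x c + 1 / 2)⌋ = (i c : ℕ) := by
  have hm' : (0 : ℝ) < m := Nat.cast_pos.2 hm
  simp only [unitTile, halfOpenSquare, mem_univ_pi, mem_Ico, Int.floor_eq_iff]
  refine forall_congr' fun c => and_congr ?_ ?_
  · rw [Int.cast_natCast, ← div_le_iff₀' hm', neg_add_le_iff_le_add, add_comm]
  · rw [Int.cast_natCast, ← lt_div_iff₀' hm', add_div, add_assoc, lt_neg_add_iff_add_lt, add_comm]

lemma measurableSet_unitTile (m : ℕ) (i : Fin 2 → Fin m) : MeasurableSet (unitTile m i) :=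
  measurableSet_halfOpenSquare _ _

lemma pairwise_disjoint_unitTile {m : ℕ} (hm : 0 < m) :
    Pairwise fun i j : Fin 2 → Fin m => Disjoint (unitTile m i) (unitTile m j) := by
  refine fun i j hij => disjoint_left.2 fun x hi hj => hij (funext fun c => Fin.ext ?_)
  exact_mod_cast ((mem_unitTile hm).1 hi c).symm.trans ((mem_unitTile hm).1 hj c)

lemma iUnion_unitTile {m : ℕ} (hm : 0 < m) : ⋃ i, unitTile m i = unitCell := by
  have hm' : (0 : ℝ) < m := Nat.cast_pos.2 hm
  have hfloor (t : ℝ) : (∃ j : Fin m, ⌊m * (t + 1 / 2)⌋ = (j : ℕ)) ↔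
      t ∈ Ico (-(1 / 2)) (-(1 / 2) + 1) := by
    trans 0 ≤ ⌊m * (t + 1 / 2)⌋ ∧ ⌊m * (t + 1 / 2)⌋ < m
    · refine ⟨fun ⟨j, hj⟩ => hj ▸ ⟨by positivity, by exact_mod_cast j.isLt⟩, fun ⟨h0, hlt⟩ => ?_⟩
      lift ⌊m * (t + 1 / 2)⌋ to ℕ using h0 with j
      exact ⟨⟨j, by exact_mod_cast hlt⟩, rfl⟩
    · rw [Int.floor_nonneg, Int.floor_lt, Int.cast_natCast, mul_nonneg_iff_of_pos_left hm',
        mul_lt_iff_lt_one_right hm', mem_Ico]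
      constructor <;> rintro ⟨_, _⟩ <;> constructor <;> linarith
  ext x
  simp only [mem_iUnion, mem_unitTile hm, unitCell, halfOpenSquare, mem_univ_pi, ← hfloor,
    Classical.skolem]

lemma dist_le_of_mem_unitTile {m : ℕ} {i : Fin 2 → Fin m} {x y : Plane} (hx : x ∈ unitTile m i)
    (hy : y ∈ unitTile m i) : dist x y ≤ 1 / m := by
  refine (dist_pi_le_iff (by positivity)).2 fun c => ?_
  have hxc := hx c (mem_univ c)
  have hyc := hy c (mem_univ c)
  rw [Real.dist_eq, abs_le]
  constructor <;> linarith [hxc.1, hxc.2, hyc.1, hyc.2]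

lemma smallSquare_eq_bigSquare (s : Fin 2 → ℤ) {m : ℕ} (hm : 0 < m) (a : ℕ) (i : Fin 2 → Fin m) :
    smallSquare s (m * a) m i = bigSquare (tileVertex s a i) a := by
  have hside : ((m * a : ℕ) : ℝ) / m = a := by
    have : (m : ℝ) ≠ 0 := Nat.cast_ne_zero.2 hm.ne'
    push_cast
    field_simp
  simp only [smallSquare, bigSquare, tileVertex, hside]
  push_cast
  simp only [add_mul, one_mul, add_assoc]

lemma chart_eq_smul_add (s : Fin 2 → ℤ) (l : ℕ) (x : Plane) :
    chart s l x = (l : ℝ)⁻¹ • x + fun c => -(s c : ℝ) / l - 1 / 2 := by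
  funext c
  simp only [chart, Pi.add_apply, Pi.smul_apply, smul_eq_mul]
  ring

lemma continuous_chart (s : Fin 2 → ℤ) (l : ℕ) : Continuous (chart s l) := by
  unfold chart
  fun_prop

lemma chart_injective (s : Fin 2 → ℤ) {l : ℕ} (hl : 0 < l) : Function.Injective (chart s l) :=
  Function.LeftInverse.injective (chartInv_chart s hl)

lemma dist_chart (s : Fin 2 → ℤ) (l : ℕ) (x y : Plane) :
    dist (chart s l x) (chart s l y) = dist x y / l := by
  rw [chart_eq_smul_add, chart_eq_smul_add, dist_add_right, dist_smul₀, norm_inv,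
    Real.norm_natCast, inv_mul_eq_div]

lemma chart_preimage_halfOpenSquare (s : Fin 2 → ℤ) {l : ℕ} (hl : 0 < l) (v : Plane) (a : ℝ) :
    chart s l ⁻¹' halfOpenSquare v a = halfOpenSquare (chartInv s l v) (l * a) := by
  have hl' : (0 : ℝ) < l := Nat.cast_pos.2 hl
  ext x
  simp only [halfOpenSquare, mem_preimage, mem_univ_pi, mem_Ico, chart, chartInv]
  refine forall_congr' fun c => and_congr ?_ ?_
  · rw [le_sub_iff_add_le, le_div_iff₀' hl', le_sub_iff_add_le']
  · rw [sub_lt_iff_lt_add, div_lt_iff₀' hl', sub_lt_iff_lt_add', add_right_comm, mul_add, add_assoc]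

lemma chart_preimage_unitCell (s : Fin 2 → ℤ) {l : ℕ} (hl : 0 < l) :
    chart s l ⁻¹' unitCell = halfOpenSquare (toPlane s) l := by
  rw [unitCell, chart_preimage_halfOpenSquare s hl]
  congr 1 <;> simp [chartInv, toPlane, funext_iff]

lemma chart_preimage_unitTile (s : Fin 2 → ℤ) {m a : ℕ} (hm : 0 < m) (ha : 0 < a)
    (i : Fin 2 → Fin m) :
    chart s (m * a) ⁻¹' unitTile m i = halfOpenSquare (toPlane (tileVertex s a i)) a := by
  have hm' : (m : ℝ) ≠ 0 := Nat.cast_ne_zero.2 hm.ne'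
  rw [unitTile, chart_preimage_halfOpenSquare s (Nat.mul_pos hm ha)]
  congr 1
  · funext c
    simp only [chartInv, toPlane, tileVertex]
    push_cast
    field_simp
    ring
  · push_cast
    field_simp

lemma chart_preimage_unitSquare (s : Fin 2 → ℤ) {l : ℕ} (hl : 0 < l) :
    chart s l ⁻¹' unitSquare = bigSquare s l := by
  have hl' : (0 : ℝ) < l := Nat.cast_pos.2 hl
  ext x
  simp only [unitSquare, bigSquare, mem_preimage, mem_Icc, Pi.le_def, ← forall_and, chart]
  refine forall_congr' fun c => and_congr ?_ ?_
  · rw [neg_le_sub_iff_le_add, le_add_iff_nonneg_left, le_div_iff₀ hl', zero_mul, sub_nonneg]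
  · rw [sub_le_iff_le_add, add_halves, div_le_one hl', sub_le_iff_le_add']

lemma setIntegral_chart_preimage (s : Fin 2 → ℤ) (l : ℕ) (G : Plane → ℝ) {A : Set Plane}
    (hA : MeasurableSet A) :
    ∫ x in chart s l ⁻¹' A, G (chart s l x) = (l : ℝ) ^ 2 * ∫ x in A, G x := by
  rw [← integral_indicator ((continuous_chart s l).measurable hA), ← integral_indicator hA]
  calc ∫ x, (chart s l ⁻¹' A).indicator (fun x => G (chart s l x)) x
      = ∫ x, A.indicator G (chart s l x) := rfl
    _ = (l : ℝ) ^ 2 * ∫ x, A.indicator G x := by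
      simp only [chart_eq_smul_add]
      rw [Measure.integral_comp_smul volume (fun x => A.indicator G (x + _)),
        integral_add_right_eq_self (fun x => A.indicator G x)]
      simp

/-- The measure `l⁻² ∑ δ_x`, where `x` runs over the rescaled set `R = φ(D ∩ S)`. -/
noncomputable def empiricalMeasure (s : Fin 2 → ℤ) (l : ℕ) (D : Set Plane) : Measure Plane :=
  ((l : ENNReal) ^ 2)⁻¹ • Measure.count.restrict (rescaledSet s l D)

lemma rescaledSet_eq_inter (s : Fin 2 → ℤ) {l : ℕ} (hl : 0 < l) (D : Set Plane) :
    rescaledSet s l D = chart s l '' D ∩ unitSquare := by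
  rw [rescaledSet, ← chart_preimage_unitSquare s hl, image_inter_preimage]

lemma finite_rescaledSet {D : Set Plane} (hD : D ⊆ lattice) (s : Fin 2 → ℤ) (l : ℕ) :
    (rescaledSet s l D).Finite :=
  ((finite_lattice_inter_bigSquare s l).subset (inter_subset_inter_left _ hD)).image _

lemma isFiniteMeasure_empiricalMeasure {D : Set Plane} (hD : D ⊆ lattice) (s : Fin 2 → ℤ) {l : ℕ}
    (hl : 0 < l) : IsFiniteMeasure (empiricalMeasure s l D) := by
  have hfin := finite_rescaledSet hD s l
  have : IsFiniteMeasure (Measure.count.restrict (rescaledSet s l D)) :=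
    isFiniteMeasure_restrict.2 (Measure.count_apply_lt_top.2 hfin).ne
  exact Measure.smul_finite _ (ENNReal.inv_ne_top.2 (by positivity))

lemma empiricalMeasure_real {D : Set Plane} (hD : D ⊆ lattice) (s : Fin 2 → ℤ) {l : ℕ} (hl : 0 < l)
    {A : Set Plane} (hA : MeasurableSet A) (hAI : A ⊆ unitSquare) :
    (empiricalMeasure s l D).real A = (D ∩ chart s l ⁻¹' A).ncard / (l : ℝ) ^ 2 := by
  have himage : A ∩ rescaledSet s l D = chart s l '' (D ∩ chart s l ⁻¹' A) := by
    rw [rescaledSet_eq_inter s hl, image_inter_preimage, inter_left_comm, inter_eq_left.2 hAI]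
  have hfin : (A ∩ rescaledSet s l D).Finite := (finite_rescaledSet hD s l).inter_of_right A
  rw [empiricalMeasure, measureReal_ennreal_smul_apply, measureReal_restrict_apply hA,
    measureReal_def, Measure.count_apply hfin.measurableSet, ← hfin.cast_ncard_eq, himage,
    ncard_image_of_injective _ (chart_injective s hl), div_eq_inv_mul]
  simp

lemma setIntegral_empiricalMeasure {D : Set Plane} (hD : D ⊆ lattice) (s : Fin 2 → ℤ) (l : ℕ)
    {A : Set Plane} (hA : MeasurableSet A) (h : Plane → ℝ) :
    ∫ x in A, h x ∂empiricalMeasure s l D =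
      (∑' x : ↥(rescaledSet s l D ∩ A), h x) / (l : ℝ) ^ 2 := by
  have hfin : (rescaledSet s l D ∩ A).Finite := (finite_rescaledSet hD s l).inter_of_left A
  have hint : IntegrableOn h (rescaledSet s l D ∩ A) Measure.count := by
    rw [← biUnion_of_singleton (rescaledSet s l D ∩ A), integrableOn_finite_biUnion hfin]
    exact fun x _ => integrableOn_singleton (hx := by simp)
  rw [empiricalMeasure, Measure.restrict_smul, Measure.restrict_restrict hA, inter_comm,
    integral_smul_measure, setIntegral_countable h hfin.countable hint]
  simp [div_eq_inv_mul]

lemma isFiniteMeasure_densityMeasure {ρ : Plane → ℝ} (hρ : ContinuousOn ρ unitSquare) :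
    IsFiniteMeasure (densityMeasure ρ) :=
  isFiniteMeasure_withDensity_ofReal
    (hρ.integrableOn_compact isCompact_unitSquare : Integrable ρ _).2

lemma densityMeasure_real {ρ : Plane → ℝ} (hρ : ContinuousOn ρ unitSquare)
    (hρ0 : ∀ x ∈ unitSquare, 0 ≤ ρ x) {A : Set Plane} (hA : MeasurableSet A)
    (hAI : A ⊆ unitSquare) : (densityMeasure ρ).real A = ∫ x in A, ρ x := by
  rw [measureReal_def, densityMeasure, withDensity_apply _ hA, Measure.restrict_restrict hA,
    inter_eq_left.2 hAI, integral_eq_lintegral_of_nonneg_ae]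
  · exact ae_restrict_of_forall_mem hA fun x hx => hρ0 x (hAI hx)
  · exact ((hρ.mono hAI).aestronglyMeasurable hA)

lemma densityMeasure_real_eq_chart_preimage {ρ : Plane → ℝ} (hρ : ContinuousOn ρ unitSquare)
    (hρ0 : ∀ x ∈ unitSquare, 0 ≤ ρ x) (s : Fin 2 → ℤ) {l : ℕ} (hl : 0 < l) {A : Set Plane}
    (hA : MeasurableSet A) (hAI : A ⊆ unitSquare) :
    (densityMeasure ρ).real A = (∫ x in chart s l ⁻¹' A, ρ (chart s l x)) / (l : ℝ) ^ 2 := by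
  have hl' : (l : ℝ) ≠ 0 := Nat.cast_ne_zero.2 hl.ne'
  rw [densityMeasure_real hρ hρ0 hA hAI, setIntegral_chart_preimage s l ρ hA]
  field_simp

lemma unitTile_subset_unitSquare {m : ℕ} (hm : 0 < m) (i : Fin 2 → Fin m) :
    unitTile m i ⊆ unitSquare :=
  ((subset_iUnion _ i).trans (iUnion_unitTile hm).subset).trans unitCell_subset_unitSquare

lemma empiricalMeasure_real_unitCell_le {D : Set Plane} (hD : D ⊆ lattice) (s : Fin 2 → ℤ)
    {l : ℕ} (hl : 0 < l) : (empiricalMeasure s l D).real unitCell ≤ 1 := by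
  rw [empiricalMeasure_real hD s hl measurableSet_unitCell unitCell_subset_unitSquare,
    chart_preimage_unitCell s hl]
  exact div_le_one_of_le₀ (by exact_mod_cast ncard_inter_halfOpenSquare_le hD s l) (by positivity)

lemma IsDensitySet.abs_empiricalMeasure_sub_densityMeasure_le {l m : ℕ → ℕ}
    {s : ℕ → Fin 2 → ℤ} {ρ : Plane → ℝ} {D : Set Plane} (hD : IsDensitySet l m s ρ D)
    (hρ : ContinuousOn ρ unitSquare) (hρ0 : ∀ x ∈ unitSquare, 0 ≤ ρ x) {n a : ℕ}
    (hm : 0 < m n) (ha : 0 < a) (hl : l n = m n * a) (i : Fin 2 → Fin (m n)) :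
    |(empiricalMeasure (s n) (l n) D).real (unitTile (m n) i) -
      (densityMeasure ρ).real (unitTile (m n) i)| ≤ (2 * a + 2) / (l n : ℝ) ^ 2 := by
  have hcard := hD.card_eq n i
  have hmeas := measurableSet_unitTile (m n) i
  have hsub := unitTile_subset_unitSquare hm i
  rw [hl] at hcard ⊢
  have hl0 : 0 < m n * a := Nat.mul_pos hm ha
  rw [smallSquare_eq_bigSquare (s n) hm a i, ← setIntegral_congr_set
    (halfOpenSquare_ae_eq_bigSquare (tileVertex (s n) a i) a)] at hcard
  rw [empiricalMeasure_real hD.subset_lattice (s n) hl0 hmeas hsub,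
    densityMeasure_real_eq_chart_preimage hρ hρ0 (s n) hl0 hmeas hsub,
    chart_preimage_unitTile (s n) hm ha, ← sub_div, abs_div, abs_sq]
  gcongr
  refine abs_ncard_inter_halfOpenSquare_sub_le hD.subset_lattice ?_ hcard
  rw [← chart_preimage_unitTile (s n) hm ha]
  exact setIntegral_nonneg ((continuous_chart _ _).measurable hmeas) fun x hx => hρ0 _ (hsub hx)

lemma IsDensitySet.sum_abs_empiricalMeasure_sub_densityMeasure_le {l m : ℕ → ℕ}
    {s : ℕ → Fin 2 → ℤ} (hS : IsSquareSystem l m s) {ρ : Plane → ℝ}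
    (hρ : ContinuousOn ρ unitSquare) (hρ0 : ∀ x ∈ unitSquare, 0 ≤ ρ x) {D : Set Plane}
    (hD : IsDensitySet l m s ρ D) (n : ℕ) :
    ∑ i, |(empiricalMeasure (s n) (l n) D).real (unitTile (m n) i) -
      (densityMeasure ρ).real (unitTile (m n) i)| ≤ 4 * ((l n : ℝ) / m n)⁻¹ := by
  have hm := hS.m_pos n
  obtain ⟨a, hl⟩ := hS.m_dvd_l n
  have ha : 0 < a := Nat.pos_of_mul_pos_left (hl ▸ hS.l_pos n)
  have ha' : (1 : ℝ) ≤ a := Nat.one_le_cast.2 ha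
  calc ∑ i, |(empiricalMeasure (s n) (l n) D).real (unitTile (m n) i) -
        (densityMeasure ρ).real (unitTile (m n) i)|
      ≤ ∑ _i : Fin 2 → Fin (m n), (2 * a + 2) / (l n : ℝ) ^ 2 := Finset.sum_le_sum fun i _ =>
        hD.abs_empiricalMeasure_sub_densityMeasure_le hρ hρ0 hm ha hl i
    _ = (2 * a + 2) / (a : ℝ) ^ 2 := by
      simp only [Finset.sum_const, Finset.card_univ, Fintype.card_fun, Fintype.card_fin,
        nsmul_eq_mul, hl]
      push_cast
      field_simp
    _ ≤ 4 / a := by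
      rw [div_le_div_iff₀ (by positivity) (by positivity)]
      nlinarith
    _ = 4 * ((l n : ℝ) / m n)⁻¹ := by
      rw [hl]
      push_cast
      field_simp

lemma setIntegral_unitCell_densityMeasure (ρ h : Plane → ℝ) :
    ∫ x in unitCell, h x ∂densityMeasure ρ = ∫ x, h x ∂densityMeasure ρ := by
  have hac : densityMeasure ρ ≪ volume.restrict unitSquare := withDensity_absolutelyContinuous _ _
  have hcell : ∀ᵐ x ∂densityMeasure ρ, x ∈ unitCell := hac.ae_le <| by
    rw [← Measure.restrict_congr_set unitCell_ae_eq_unitSquare]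
    exact ae_restrict_mem measurableSet_unitCell
  rw [Measure.restrict_eq_self_of_ae_mem hcell]

lemma IsDensitySet.tendsto_setIntegral_empiricalMeasure {l m : ℕ → ℕ} {s : ℕ → Fin 2 → ℤ}
    (hS : IsSquareSystem l m s) {ρ : Plane → ℝ} (hρ : ContinuousOn ρ unitSquare)
    (hρ0 : ∀ x ∈ unitSquare, 0 ≤ ρ x) {D : Set Plane} (hD : IsDensitySet l m s ρ D) {h : Plane → ℝ}
    (hh : ContinuousOn h unitSquare) :
    Tendsto (fun n => ∫ x in unitCell, h x ∂empiricalMeasure (s n) (l n) D) atTop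
      (𝓝 (∫ x, h x ∂densityMeasure ρ)) := by
  have hDl := hD.subset_lattice
  have := isFiniteMeasure_densityMeasure hρ
  have (n : ℕ) : IsFiniteMeasure (empiricalMeasure (s n) (l n) D) :=
    isFiniteMeasure_empiricalMeasure hDl (s n) (hS.l_pos n)
  have hint (μ : Measure Plane) [IsFiniteMeasure μ] : IntegrableOn h unitCell μ :=
    (hh.integrableOn_compact isCompact_unitSquare).mono_set unitCell_subset_unitSquare
  obtain ⟨M, hM⟩ := isCompact_unitSquare.exists_bound_of_continuousOn hh
  rw [← setIntegral_unitCell_densityMeasure]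
  refine tendsto_setIntegral_of_tendsto_sum_abs_sub (fun n => measurableSet_unitTile (m n))
    (fun n => pairwise_disjoint_unitTile (hS.m_pos n)) (fun n => iUnion_unitTile (hS.m_pos n))
    (tendsto_one_div_atTop_nhds_zero_nat.comp hS.m_tendsto)
    (fun n i x hx y hy => dist_le_of_mem_unitTile hx hy) (fun n => measure_ne_top _ _)
    (fun n => empiricalMeasure_real_unitCell_le hDl (s n) (hS.l_pos n)) (measure_ne_top _ _)
    ?_ (fun x hx => hM x (unitCell_subset_unitSquare hx))
    ((isCompact_unitSquare.uniformContinuousOn_of_continuous hh).mono unitCell_subset_unitSquare)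
    (fun n => hint _) (hint _)
  have hsmall : Tendsto (fun n => 4 * ((l n : ℝ) / m n)⁻¹) atTop (𝓝 0) := by
    simpa using hS.ratio_tendsto.inv_tendsto_atTop.const_mul 4
  exact squeeze_zero (fun n => Finset.sum_nonneg fun i _ => abs_nonneg _)
    (fun n => hD.sum_abs_empiricalMeasure_sub_densityMeasure_le hS hρ hρ0 n) hsmall

lemma sub_mem_lattice_iff {x b : Plane} (hb : b ∈ lattice) : x - b ∈ lattice ↔ x ∈ lattice := by
  obtain ⟨z, rfl⟩ : b ∈ range toPlane := range_toPlane.symm ▸ hb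
  refine forall_congr' fun c => ⟨fun ⟨k, hk⟩ => ⟨k + z c, ?_⟩, fun ⟨k, hk⟩ => ⟨k - z c, ?_⟩⟩
  · rw [Int.cast_add, ← hk, Pi.sub_apply, toPlane, sub_add_cancel]
  · rw [Int.cast_sub, ← hk, Pi.sub_apply, toPlane]

lemma bijOn_normalizedMap {f : Plane → Plane} {D : Set Plane} (hf : BijOn f D lattice)
    (s : Fin 2 → ℤ) {l : ℕ} (hl : 0 < l) {x₀ : Plane} (hx₀ : x₀ ∈ chart s l '' D) :
    BijOn (normalizedMap s l f x₀) (chart s l '' D) (scaledLattice l) := by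
  have hchartInv : BijOn (chartInv s l) (chart s l '' D) D :=
    BijOn.symm ⟨fun x _ => chart_chartInv s hl x, fun x _ => chartInv_chart s hl x⟩
      (chart_injective s hl).injOn.bijOn_image
  have hb : f (chartInv s l x₀) ∈ lattice := hf.mapsTo (hchartInv.mapsTo hx₀)
  have htranslate : BijOn (· - f (chartInv s l x₀)) lattice lattice :=
    (Equiv.subRight (f (chartInv s l x₀))).bijOn fun x => sub_mem_lattice_iff hb
  have hscale : BijOn (fun x : Plane => (1 / (l : ℝ)) • x) lattice (scaledLattice l) :=
    (smul_right_injective Plane (by positivity : 1 / (l : ℝ) ≠ 0)).injOn.bijOn_image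
  exact hscale.comp (htranslate.comp (hf.comp hchartInv))

lemma antilipschitzWith_normalizedMap {f : Plane → Plane} {D : Set Plane} {K : ℝ≥0}
    (hf : AntilipschitzWith K (D.domRestrict f)) (s : Fin 2 → ℤ) {l : ℕ} (hl : 0 < l)
    (x₀ : Plane) :
    AntilipschitzWith K ((chart s l '' D).domRestrict (normalizedMap s l f x₀)) := by
  refine AntilipschitzWith.of_le_mul_dist ?_
  rintro ⟨_, x, hx, rfl⟩ ⟨_, y, hy, rfl⟩
  simp only [Subtype.dist_eq, domRestrict_apply, normalizedMap, chartInv_chart s hl, dist_chart,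
    dist_smul₀, dist_sub_right]
  rw [norm_div, norm_one, Real.norm_natCast, mul_left_comm, one_div_mul_eq_div]
  gcongr
  exact hf.le_mul_dist ⟨x, hx⟩ ⟨y, hy⟩

lemma exists_toPlane_mem_halfOpenSquare (s : Fin 2 → ℤ) (l : ℕ) {p : Plane}
    (hp : p ∈ halfOpenSquare (toPlane s) l) :
    ∃ z : Fin 2 → ℤ, toPlane (s + 2 • z) ∈ halfOpenSquare (toPlane s) l ∧
      dist (toPlane (s + 2 • z)) p ≤ 2 := by
  let z (c : Fin 2) : ℤ := ⌊(p c - s c) / 2⌋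
  have hcoord (c : Fin 2) : toPlane (s + 2 • z) c = s c + 2 * z c := by simp [toPlane]
  have hle (c : Fin 2) : (s c + 2 * z c : ℝ) ≤ p c := by
    linarith [Int.floor_le ((p c - s c) / 2)]
  have hlt (c : Fin 2) : p c < s c + 2 * z c + 2 := by
    linarith [Int.lt_floor_add_one ((p c - s c) / 2)]
  refine ⟨z, fun c _ => ?_, (dist_pi_le_iff zero_le_two).2 fun c => ?_⟩
  · have hpc : (s c : ℝ) ≤ p c ∧ p c < s c + l := hp c (mem_univ c)
    have hz : (0 : ℝ) ≤ z c := Int.cast_nonneg (Int.floor_nonneg.2 (by linarith))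
    rw [hcoord]
    exact ⟨le_add_of_nonneg_right (by positivity), (hle c).trans_lt hpc.2⟩
  · rw [hcoord, Real.dist_eq, abs_le]
    constructor <;> linarith [hle c, hlt c]

lemma IsDensitySet.evenFirst_inter_halfOpenSquare_subset {l m : ℕ → ℕ} {s : ℕ → Fin 2 → ℤ}
    (hS : IsSquareSystem l m s) {ρ : Plane → ℝ} {D : Set Plane} (hD : IsDensitySet l m s ρ D)
    (n : ℕ) : evenFirst ∩ halfOpenSquare (toPlane (s n)) (l n) ⊆ D := by
  rintro x ⟨hxeven, hx⟩
  have hm := hS.m_pos n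
  obtain ⟨a, hl⟩ := hS.m_dvd_l n
  have ha : 0 < a := Nat.pos_of_mul_pos_left (hl ▸ hS.l_pos n)
  rw [← chart_preimage_unitCell _ (hS.l_pos n), mem_preimage, ← iUnion_unitTile hm,
    mem_iUnion] at hx
  obtain ⟨i, hi⟩ := hx
  rw [← mem_preimage, hl, chart_preimage_unitTile _ hm ha] at hi
  refine hD.evenFirst_subset n i ⟨?_, hxeven⟩
  rw [hl, smallSquare_eq_bigSquare _ hm]
  exact halfOpenSquare_subset_bigSquare _ _ hi

lemma IsDensitySet.exists_mem_rescaledSet_dist_le {l m : ℕ → ℕ} {s : ℕ → Fin 2 → ℤ}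
    (hS : IsSquareSystem l m s) {ρ : Plane → ℝ} {D : Set Plane} (hD : IsDensitySet l m s ρ D)
    (n : ℕ) {q : Plane} (hq : q ∈ unitCell) :
    ∃ u ∈ rescaledSet (s n) (l n) D, dist u q ≤ 2 / l n := by
  have hl := hS.l_pos n
  rw [← chart_chartInv (s n) hl q, ← mem_preimage, chart_preimage_unitCell _ hl] at hq
  obtain ⟨z, hz, hdist⟩ := exists_toPlane_mem_halfOpenSquare (s n) (l n) hq
  have heven : toPlane (s n + 2 • z) ∈ evenFirst := by
    obtain ⟨t, ht⟩ := hS.vertex_even n 0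
    refine ⟨range_toPlane ▸ mem_range_self _, t + z 0, ?_⟩
    calc toPlane (s n + 2 • z) 0 = t + t + 2 * z 0 := by simp [toPlane, ht]
      _ = 2 * (t + z 0 : ℤ) := by push_cast; ring
  refine ⟨_, mem_image_of_mem _ ⟨hD.evenFirst_inter_halfOpenSquare_subset hS n ⟨heven, hz⟩,
    halfOpenSquare_subset_bigSquare _ _ hz⟩, ?_⟩
  rw [← chart_chartInv (s n) hl q, dist_chart]
  gcongr

/-- `G` is a possible choice of the map `\hat f_n`: an `L`-Lipschitz extension to the unit square
of the normalization of `f` on `R = φ(D ∩ S)`, with base point `x₀ ∈ R`. -/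
structure IsNormalizedExtension (s : Fin 2 → ℤ) (l : ℕ) (D : Set Plane) (f : Plane → Plane)
    (L : ℝ≥0) (x₀ : Plane) (G : Plane → Plane) : Prop where
  base_mem : x₀ ∈ rescaledSet s l D
  lipschitzOnWith : LipschitzOnWith L G unitSquare
  eqOn : EqOn G (normalizedMap s l f x₀) (rescaledSet s l D)

section NormalizedExtension

variable {D : Set Plane} {f F : Plane → Plane} {K L : ℝ≥0}

lemma IsNormalizedExtension.bijOn_normalizedMap {s : Fin 2 → ℤ} {l : ℕ} {x₀ : Plane}
    {G : Plane → Plane} (hG : IsNormalizedExtension s l D f L x₀ G) (hf : BijOn f D lattice)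
    (hl : 0 < l) : BijOn (normalizedMap s l f x₀) (chart s l '' D) (scaledLattice l) :=
  DeloneRenorm.bijOn_normalizedMap hf s hl (image_mono inter_subset_left hG.base_mem)

lemma IsNormalizedExtension.mapsTo {s : Fin 2 → ℤ} {l : ℕ} {x₀ : Plane} {G : Plane → Plane}
    (hG : IsNormalizedExtension s l D f L x₀ G) (hf : BijOn f D lattice) (hl : 0 < l) :
    MapsTo G (rescaledSet s l D) (scaledLattice l) :=
  ((hG.bijOn_normalizedMap hf hl).mapsTo.mono_left (image_mono inter_subset_left)).congr
    hG.eqOn.symm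

lemma IsNormalizedExtension.injOn {s : Fin 2 → ℤ} {l : ℕ} {x₀ : Plane} {G : Plane → Plane}
    (hG : IsNormalizedExtension s l D f L x₀ G) (hf : BijOn f D lattice) (hl : 0 < l) :
    InjOn G (rescaledSet s l D) :=
  ((hG.bijOn_normalizedMap hf hl).injOn.mono (image_mono inter_subset_left)).congr hG.eqOn.symm

variable {l m : ℕ → ℕ} {s : ℕ → Fin 2 → ℤ} {ρ : Plane → ℝ}

lemma IsNormalizedExtension.scaledLattice_inter_subset_image (hS : IsSquareSystem l m s)
    (hD : IsDensitySet l m s ρ D) (hf : BijOn f D lattice)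
    (hfK : AntilipschitzWith K (D.domRestrict f)) {n : ℕ} {x₀ : Plane} {G : Plane → Plane}
    (hG : IsNormalizedExtension (s n) (l n) D f L x₀ G) {E : Set Plane} (hEF : E ⊆ F '' unitSquare)
    {ε δ : ℝ} (hGF : ∀ q ∈ unitSquare, dist (F q) (G q) ≤ ε)
    (hδ : Metric.thickening δ (unitSquare ∩ F ⁻¹' E) ⊆ unitSquare)
    (hεδ : K * (ε + L * (2 / l n)) + 2 / l n < δ) :
    scaledLattice (l n) ∩ E ⊆ G '' (rescaledSet (s n) (l n) D ∩ unitCell) := by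
  rintro p ⟨hp, hpE⟩
  have hl := hS.l_pos n
  have hcell : Metric.thickening δ (unitSquare ∩ F ⁻¹' E) ⊆ unitCell :=
    (interior_maximal hδ Metric.isOpen_thickening).trans interior_unitSquare_subset_unitCell
  obtain ⟨q, hq, rfl⟩ := hEF hpE
  have hdist := hGF q hq
  have hδ0 : 0 < δ := lt_of_le_of_lt
    (by have := dist_nonneg.trans hdist; positivity) hεδ
  obtain ⟨u, hu, huq⟩ := hD.exists_mem_rescaledSet_dist_le hS n
    (hcell (Metric.self_subset_thickening hδ0 _ ⟨hq, hpE⟩))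
  rw [rescaledSet_eq_inter _ hl] at hu
  obtain ⟨x, hxD, hxp, hxq⟩ := exists_eq_and_dist_le (hG.bijOn_normalizedMap hf hl).surjOn
    (antilipschitzWith_normalizedMap hfK (s n) hl x₀) hG.lipschitzOnWith
    (rescaledSet_eq_inter (s n) hl D ▸ hG.eqOn) hu hq huq hp hdist
  have hx : x ∈ unitCell :=
    hcell (Metric.mem_thickening_iff.2 ⟨q, ⟨hq, hpE⟩, hxq.trans_lt hεδ⟩)
  have hxR : x ∈ rescaledSet (s n) (l n) D :=
    (rescaledSet_eq_inter (s n) hl D).symm ▸ ⟨hxD, unitCell_subset_unitSquare hx⟩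
  exact ⟨x, ⟨hxR, hx⟩, (hG.eqOn hxR).trans hxp⟩

variable {x₀ : ℕ → Plane} {G : ℕ → Plane → Plane} {σ : ℕ → ℕ}

lemma IsNormalizedExtension.eventually_image_inter_eq (hS : IsSquareSystem l m s)
    (hD : IsDensitySet l m s ρ D) (hf : BijOn f D lattice)
    (hfK : AntilipschitzWith K (D.domRestrict f))
    (hG : ∀ n, IsNormalizedExtension (s n) (l n) D f L (x₀ n) (G n)) (hσ : StrictMono σ)
    (hGF : TendstoUniformlyOn (fun k => G (σ k)) F atTop unitSquare)
    (hF : ContinuousOn F unitSquare) {W : Set Plane} (hWF : W ⊆ F '' unitSquare)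
    (hW : IsOpen (unitSquare ∩ F ⁻¹' W)) {E : Set Plane} (hE : IsCompact E) (hEW : E ⊆ W) :
    ∀ᶠ k in atTop, G (σ k) '' (rescaledSet (s (σ k)) (l (σ k)) D ∩ unitCell) ∩ E =
      scaledLattice (l (σ k)) ∩ E := by
  have hcompact : IsCompact (unitSquare ∩ F ⁻¹' E) := isCompact_unitSquare.of_isClosed_subset
    (hF.preimage_isClosed_of_isClosed isCompact_unitSquare.isClosed hE.isClosed) inter_subset_left
  obtain ⟨δ, hδ, hthick⟩ := hcompact.exists_thickening_subset_open hW
    (inter_subset_inter_right _ (preimage_mono hEW))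
  obtain ⟨ε, hε, hεδ⟩ : ∃ ε > 0, K * ε < δ :=
    ⟨δ / (K + 1), by positivity, by rw [mul_div_assoc', div_lt_iff₀ (by positivity)]; nlinarith⟩
  have hinv : Tendsto (fun k => (2 : ℝ) / l (σ k)) atTop (𝓝 0) :=
    (tendsto_const_div_atTop_nhds_zero_nat 2).comp (hS.l_tendsto.comp hσ.tendsto_atTop)
  have hlim : Tendsto (fun k => K * (ε + L * (2 / l (σ k))) + 2 / l (σ k)) atTop (𝓝 (K * ε)) := by
    simpa using (((hinv.const_mul (L : ℝ)).const_add ε).const_mul (K : ℝ)).add hinv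
  filter_upwards [hlim.eventually_lt_const hεδ, Metric.tendstoUniformlyOn_iff.1 hGF ε hε]
    with k hk hGFk
  refine subset_antisymm (inter_subset_inter_left _ ?_) (subset_inter ?_ inter_subset_right)
  · exact ((hG _).mapsTo hf (hS.l_pos _)).image_subset.trans' (image_mono inter_subset_left)
  · exact (hG _).scaledLattice_inter_subset_image hS hD hf hfK (hEW.trans hWF)
      (fun q hq => (hGFk q hq).le) (hthick.trans inter_subset_left) hk

lemma IsNormalizedExtension.eventually_setIntegral_comp_eq (hS : IsSquareSystem l m s)
    (hD : IsDensitySet l m s ρ D) (hf : BijOn f D lattice)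
    (hfK : AntilipschitzWith K (D.domRestrict f))
    (hG : ∀ n, IsNormalizedExtension (s n) (l n) D f L (x₀ n) (G n)) (hσ : StrictMono σ)
    (hGF : TendstoUniformlyOn (fun k => G (σ k)) F atTop unitSquare)
    (hF : ContinuousOn F unitSquare) {W : Set Plane} (hWF : W ⊆ F '' unitSquare)
    (hW : IsOpen (unitSquare ∩ F ⁻¹' W)) {ψ : Plane → ℝ} (hψc : HasCompactSupport ψ)
    (hψW : tsupport ψ ⊆ W) :
    ∀ᶠ k in atTop, ∫ x in unitCell, ψ (G (σ k) x) ∂empiricalMeasure (s (σ k)) (l (σ k)) D =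
      (∑' p : scaledLattice (l (σ k)), ψ p) / (l (σ k) : ℝ) ^ 2 := by
  filter_upwards [eventually_image_inter_eq hS hD hf hfK hG hσ hGF hF hWF hW hψc hψW] with k hk
  have hinj := ((hG (σ k)).injOn hf (hS.l_pos _)).mono
    (inter_subset_left : rescaledSet (s (σ k)) (l (σ k)) D ∩ unitCell ⊆ _)
  rw [setIntegral_empiricalMeasure hD.subset_lattice _ _ measurableSet_unitCell
    fun x => ψ (G (σ k) x), ← tsum_image ψ hinj,
    tsum_subtype_eq_of_inter_support_eq (B := scaledLattice (l (σ k)))]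
  rw [← inter_eq_right.2 (subset_tsupport ψ), ← inter_assoc, hk, inter_assoc]

lemma IsNormalizedExtension.continuousOn_limit
    (hG : ∀ n, IsNormalizedExtension (s n) (l n) D f L (x₀ n) (G n))
    (hGF : TendstoUniformlyOn (fun k => G (σ k)) F atTop unitSquare) :
    ContinuousOn F unitSquare :=
  hGF.continuousOn (.of_forall fun k => (hG (σ k)).lipschitzOnWith.continuousOn)

lemma IsNormalizedExtension.tendsto_setIntegral_comp (hS : IsSquareSystem l m s)
    (hρ : ContinuousOn ρ unitSquare) (hρ0 : ∀ x ∈ unitSquare, 0 ≤ ρ x)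
    (hD : IsDensitySet l m s ρ D)
    (hG : ∀ n, IsNormalizedExtension (s n) (l n) D f L (x₀ n) (G n)) (hσ : StrictMono σ)
    (hGF : TendstoUniformlyOn (fun k => G (σ k)) F atTop unitSquare) {ψ : Plane → ℝ}
    (hψ : Continuous ψ) (hψc : HasCompactSupport ψ) :
    Tendsto (fun k => ∫ x in unitCell, ψ (G (σ k) x) ∂empiricalMeasure (s (σ k)) (l (σ k)) D) atTop
      (𝓝 (∫ x, ψ (F x) ∂densityMeasure ρ)) := by
  have hF := continuousOn_limit hG hGF
  have (n : ℕ) : IsFiniteMeasure (empiricalMeasure (s n) (l n) D) :=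
    isFiniteMeasure_empiricalMeasure hD.subset_lattice (s n) (hS.l_pos n)
  have hint {g : Plane → Plane} (hg : ContinuousOn g unitSquare) (n : ℕ) :
      IntegrableOn (fun x => ψ (g x)) unitCell (empiricalMeasure (s n) (l n) D) :=
    ((hψ.comp_continuousOn hg).integrableOn_compact isCompact_unitSquare).mono_set
      unitCell_subset_unitSquare
  have hunif : TendstoUniformlyOn (fun k x => ψ (G (σ k) x)) (fun x => ψ (F x)) atTop unitCell :=
    (hψc.uniformContinuous_of_continuous hψ).comp_tendstoUniformlyOn
      (hGF.mono unitCell_subset_unitSquare)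
  have hdiff := tendsto_setIntegral_sub_of_tendstoUniformlyOn (fun k => measure_ne_top _ _)
    (fun k => empiricalMeasure_real_unitCell_le hD.subset_lattice (s (σ k)) (hS.l_pos (σ k)))
    (fun k => hint (hG (σ k)).lipschitzOnWith.continuousOn _) (fun k => hint hF _) hunif
  have hequi := (hD.tendsto_setIntegral_empiricalMeasure hS hρ hρ0
    (hψ.comp_continuousOn hF)).comp hσ.tendsto_atTop
  simpa using hdiff.add hequi

lemma IsNormalizedExtension.integral_comp_eq (hS : IsSquareSystem l m s)
    (hρ : ContinuousOn ρ unitSquare) (hρ0 : ∀ x ∈ unitSquare, 0 ≤ ρ x)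
    (hD : IsDensitySet l m s ρ D) (hf : BijOn f D lattice)
    (hfK : AntilipschitzWith K (D.domRestrict f))
    (hG : ∀ n, IsNormalizedExtension (s n) (l n) D f L (x₀ n) (G n)) (hσ : StrictMono σ)
    (hGF : TendstoUniformlyOn (fun k => G (σ k)) F atTop unitSquare) {W : Set Plane}
    (hWF : W ⊆ F '' unitSquare) (hW : IsOpen (unitSquare ∩ F ⁻¹' W)) {ψ : Plane → ℝ}
    (hψ : Continuous ψ) (hψc : HasCompactSupport ψ) (hψW : tsupport ψ ⊆ W) :
    ∫ x, ψ (F x) ∂densityMeasure ρ = ∫ y, ψ y := by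
  have hlattice := (tendsto_tsum_scaledLattice_div_sq hψ hψc).comp
    (hS.l_tendsto.comp hσ.tendsto_atTop)
  exact tendsto_nhds_unique_of_eventuallyEq
    (tendsto_setIntegral_comp hS hρ hρ0 hD hG hσ hGF hψ hψc) hlattice
    (eventually_setIntegral_comp_eq hS hD hf hfK hG hσ hGF (continuousOn_limit hG hGF) hWF hW
      hψc hψW)

end NormalizedExtension

lemma IsRenormalizedLimit.exists_isNormalizedExtension {l : ℕ → ℕ} {s : ℕ → Fin 2 → ℤ}
    {D : Set Plane} {f F : Plane → Plane} {L : ℝ≥0} (hF : IsRenormalizedLimit l s D f L F) :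
    ∃ (x₀ : ℕ → Plane) (G : ℕ → Plane → Plane) (σ : ℕ → ℕ),
      (∀ n, IsNormalizedExtension (s n) (l n) D f L (x₀ n) (G n)) ∧ StrictMono σ ∧
        TendstoUniformlyOn (fun k => G (σ k)) F atTop unitSquare := by
  obtain ⟨x₀, G, σ, hx₀, hlip, heq, hσ, hlim⟩ := hF
  exact ⟨x₀, G, σ, fun n => ⟨hx₀ n, hlip n, heq n⟩, hσ, hlim⟩

lemma aemeasurable_densityMeasure {F : Plane → Plane} (hF : ContinuousOn F unitSquare)
    (ρ : Plane → ℝ) : AEMeasurable F (densityMeasure ρ) :=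
  (hF.aemeasurable isCompact_unitSquare.measurableSet).mono_ac
    (withDensity_absolutelyContinuous _ _)

end DeloneRenorm

theorem mainTheorem2_general {l m : ℕ → ℕ} {s : ℕ → Fin 2 → ℤ}
    (hS : DeloneRenorm.IsSquareSystem l m s) {ρ : DeloneRenorm.Plane → ℝ}
    (hρ : ContinuousOn ρ DeloneRenorm.unitSquare) (hρ0 : ∀ x ∈ DeloneRenorm.unitSquare, 0 ≤ ρ x)
    {D : Set DeloneRenorm.Plane} (hD : DeloneRenorm.IsDensitySet l m s ρ D) {K L : ℝ≥0}
    {f : DeloneRenorm.Plane → DeloneRenorm.Plane} (hf : BijOn f D DeloneRenorm.lattice)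
    (hfK : AntilipschitzWith K (D.domRestrict f)) {F : DeloneRenorm.Plane → DeloneRenorm.Plane}
    (hF : DeloneRenorm.IsRenormalizedLimit l s D f L F) {W : Set DeloneRenorm.Plane}
    (hW : IsOpen W) (hWF : W ⊆ F '' DeloneRenorm.unitSquare)
    (hV : IsOpen (DeloneRenorm.unitSquare ∩ F ⁻¹' W)) :
    ((DeloneRenorm.densityMeasure ρ).map F).restrict W =
      (volume : Measure DeloneRenorm.Plane).restrict W := by
  obtain ⟨x₀, G, σ, hG, hσ, hGF⟩ := hF.exists_isNormalizedExtension
  have hFmeas := DeloneRenorm.aemeasurable_densityMeasure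
    (DeloneRenorm.IsNormalizedExtension.continuousOn_limit hG hGF) ρ
  have := DeloneRenorm.isFiniteMeasure_densityMeasure hρ
  refine DeloneRenorm.restrict_eq_restrict_of_integral_eq hW fun ψ hψ hψc hψW => ?_
  rw [integral_map hFmeas hψ.aestronglyMeasurable]
  exact DeloneRenorm.IsNormalizedExtension.integral_comp_eq hS hρ hρ0 hD hf hfK hG hσ hGF hWF hV
    hψ hψc hψW

theorem mainTheorem2
    (l m : ℕ → ℕ) (s : ℕ → Fin 2 → ℤ) (hS : DeloneRenorm.IsSquareSystem l m s)
    (ρ : DeloneRenorm.Plane → ℝ) (hρ : ContinuousOn ρ DeloneRenorm.unitSquare)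
    (hρ_bd : ∀ x ∈ DeloneRenorm.unitSquare, 8 / 9 ≤ ρ x ∧ ρ x ≤ 1)
    (D : Set DeloneRenorm.Plane) (hD : DeloneRenorm.IsDensitySet l m s ρ D)
    (L : ℝ≥0) (ω : ℝ → ℝ) (hω : DeloneRenorm.IsModulus ω)
    (hω_o : ω =o[atTop] fun r : ℝ => r ^ 2)
    (f : DeloneRenorm.Plane → DeloneRenorm.Plane)
    (hf_bij : BijOn f D DeloneRenorm.lattice) (hf_lip : LipschitzOnWith L f D)
    (hf_co : DeloneRenorm.IsCoUniform ω D f)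
    (F : DeloneRenorm.Plane → DeloneRenorm.Plane)
    (hF : DeloneRenorm.IsRenormalizedLimit l s D f L F)
    (W : Set DeloneRenorm.Plane) (hW : DeloneRenorm.DecomposesOver F W)
    (k : ℕ) (y : DeloneRenorm.Plane) (hy : y ∈ DeloneRenorm.scaledLattice (l k))
    (r : ℝ) (hr : 0 < r) (hQ : Metric.closedBall y r ⊆ W) :
    ((DeloneRenorm.densityMeasure ρ).map F).restrict (Metric.closedBall y r) =
      (volume : Measure DeloneRenorm.Plane).restrict (Metric.closedBall y r) := by
  obtain ⟨hWo, hWF, N, V, hVo, -, -, hVW, -⟩ := hW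
  rw [← Measure.restrict_restrict_of_subset hQ,
    mainTheorem2_general hS hρ (fun x hx => (by norm_num : (0 : ℝ) ≤ 8 / 9).trans (hρ_bd x hx).1)
      hD hf_bij (hf_co.antilipschitzWith hf_bij) hF hWo hWF (hVW ▸ isOpen_iUnion hVo),
    Measure.restrict_restrict_of_subset hQ]
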